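/- Let $\mathbb K$ be a field, let $G$ be a finite simple graph with vertices $x_1,\dots,x_n$, and let $G'$ be the graph obtained from $G$ by attaching a whisker at every vertex, that is, by adding new vertices $y_1,\dots,y_n$ and the edges $\{x_i,y_i\}$ for $1\le i\le n$. Let $R=\mathbb K[x_1,\dots,x_n,y_1,\dots,y_n]$ with its standard grading, and let $$NI(G')=\Big\langle \prod_{v\in N_{G'}[w]} v \;:\; w\in V(G')\Big\rangle\subseteq R$$ be the closed neighborhood ideal of $G'$, where $N_{G'}[w]$ consists of $w$ and its neighbors. Let $\beta_{i,j}$ be the graded Betti numbers of $R/NI(G')$, that is, $F_i=\bigoplus_j R(-j)^{\beta_{i,j}}$ in its graded minimal free resolution, and put $\mathrm{pd}(R/NI(G'))=\max\{i:\beta_{i,j}\ne 0\text{ for some }j\}$ and $\mathrm{reg}(R/NI(G'))=\max\{j-i:\beta_{i,j}\neq 0\}$. Let $a_{G'}$ be the matching number of $G'$, the maximum number of pairwise disjoint edges. Then $$\mathrm{reg}(R/NI(G'))=a_{G'}\quad\text{and}\quad \mathrm{pd}(R/NI(G'))=a_{G'}.$$ Moreover, $NI(G')=\langle x_1y_1,\dots,x_ny_n\rangle$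 and $a_{G'}=n$, so both invariants are equal to $n$. -/

import Mathlib

open MvPolynomial

namespace SimpleGraph

/-- The graph obtained from `G` by attaching a whisker at every vertex: the vertex `Sum.inl v` is
the old vertex `v`, and `Sum.inr v` is the new leaf, which is joined to `Sum.inl v` only. -/
def whiskered {V : Type*} (G : SimpleGraph V) : SimpleGraph (V ⊕ V) where
  Adj
    | Sum.inl u, Sum.inl v => G.Adj u v
    | Sum.inl u, Sum.inr v => u = v
    | Sum.inr u, Sum.inl v => u = v
    | Sum.inr _, Sum.inr _ => False
  symm := ⟨by
    rintro (u | u) (v | v) h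
    · exact G.adj_symm h
    · exact Eq.symm h
    · exact Eq.symm h
    · exact h⟩
  loopless := ⟨by
    rintro (u | u) h
    · exact G.irrefl h
    · exact h⟩

/-- The matching number of a finite graph: the maximum number of edges of a matching. -/
noncomputable def matchingNumber {V : Type*} (G : SimpleGraph V) : ℕ :=
  sSup {k | ∃ M : G.Subgraph, M.IsMatching ∧ M.edgeSet.ncard = k}

/-- The monomial `∏ x_v`, where `v` runs over the closed neighbourhood `N[w] = N(w) ∪ {w}`. -/
noncomputable def closedNbhdMonomial {V : Type*} [Finite V] (K : Type*) [Field K]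
    (G : SimpleGraph V) (w : V) : MvPolynomial V K :=
  ∏ v ∈ (insert w (G.neighborSet w)).toFinite.toFinset, X v

/-- The closed neighbourhood ideal `NI(G)`, generated by the monomials of all closed
neighbourhoods. -/
noncomputable def closedNbhdIdeal {V : Type*} [Finite V] (K : Type*) [Field K]
    (G : SimpleGraph V) : Ideal (MvPolynomial V K) :=
  Ideal.span (Set.range (G.closedNbhdMonomial K))

end SimpleGraph

/-- In the graded free module `⨁ₐ R(-δ a)` over a polynomial ring `R`, whose basis vector with
index `a` has degree `δ a`, the vector `v` is homogeneous of degree `k`. -/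
def IsHomogeneousVector {σ K : Type*} [Field K] {r : ℕ} (δ : Fin r → ℕ) (k : ℕ)
    (v : Fin r → MvPolynomial σ K) : Prop :=
  ∀ a, ∀ m ∈ (v a).support, m.degree + δ a = k

/-- A graded minimal free resolution
`⋯ → F 2 → F 1 → F 0 → R ⧸ I → 0` of `R ⧸ I`, where `R` is a polynomial ring over a field with its
standard grading. Here `F i = ⨁ₐ R(-deg i a)`, the sum being over `a : Fin (rank i)`; the maps are
homogeneous of degree zero, and `F (i + 1)` is mapped into `𝔪 F i`, where `𝔪` is the ideal
generated by the variables. -/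
structure MinimalGradedFreeResolution {σ K : Type*} [Field K] (I : Ideal (MvPolynomial σ K)) where
  rank : ℕ → ℕ
  deg : ∀ i, Fin (rank i) → ℕ
  d : ∀ i, (Fin (rank (i + 1)) → MvPolynomial σ K) →ₗ[MvPolynomial σ K]
    (Fin (rank i) → MvPolynomial σ K)
  aug : (Fin (rank 0) → MvPolynomial σ K) →ₗ[MvPolynomial σ K] (MvPolynomial σ K ⧸ I)
  d_homogeneous : ∀ i b, IsHomogeneousVector (deg i) (deg (i + 1) b) (d i (Pi.single b 1))
  aug_homogeneous : ∀ b, ∃ p : MvPolynomial σ K,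
    p.IsHomogeneous (deg 0 b) ∧ aug (Pi.single b 1) = Ideal.Quotient.mk I p
  aug_surjective : Function.Surjective aug
  exact_zero : Function.Exact (d 0) aug
  exact_succ : ∀ i, Function.Exact (d (i + 1)) (d i)
  minimal : ∀ i v a, d i v a ∈ Ideal.span (Set.range (X : σ → MvPolynomial σ K))

namespace MinimalGradedFreeResolution

/-- The graded Betti number `β_{i,j}`: the number of summands `R(-j)` of `F i`. -/
def betti {σ K : Type*} [Field K] {I : Ideal (MvPolynomial σ K)}
    (F : MinimalGradedFreeResolution I) (i j : ℕ) : ℕ :=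
  (Finset.univ.filter fun a => F.deg i a = j).card

end MinimalGradedFreeResolution

/-- `pd (R ⧸ I) = p`, that is, `p = max {i : β_{i,j}(R ⧸ I) ≠ 0 for some j}`: the quotient has a
graded minimal free resolution, and the Betti numbers of each such resolution give this maximum. -/
def HasProjDim {σ K : Type*} [Field K] (I : Ideal (MvPolynomial σ K)) (p : ℕ) : Prop :=
  Nonempty (MinimalGradedFreeResolution I) ∧
    ∀ F : MinimalGradedFreeResolution I, IsGreatest {i : ℕ | ∃ j, F.betti i j ≠ 0} p

/-- `reg (R ⧸ I) = r`, that is, `r = max {j - i : β_{i,j}(R ⧸ I) ≠ 0}`: the quotient has a graded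
minimal free resolution, and the Betti numbers of each such resolution give this maximum. -/
def HasRegularity {σ K : Type*} [Field K] (I : Ideal (MvPolynomial σ K)) (r : ℤ) : Prop :=
  Nonempty (MinimalGradedFreeResolution I) ∧
    ∀ F : MinimalGradedFreeResolution I,
      IsGreatest {z : ℤ | ∃ i j : ℕ, F.betti i j ≠ 0 ∧ z = (j : ℤ) - (i : ℤ)} r

/-! Write `x_v`, `y_v` for `Sum.inl v`, `Sum.inr v`. The closed neighbourhood of the leaf `y_v` is
`{x_v, y_v}`, which lies inside that of `x_v`, so `NI(G')` is generated by the quadrics `x_v y_v`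
alone. These involve pairwise disjoint sets of variables, hence form a regular sequence, and the
Koszul complex resolves the quotient minimally with `n.choose i` summands `R(-2i)` in homological
degree `i`. So `β_{i,j} ≠ 0` exactly when `i ≤ n` and `j = 2i`, and both `max i` and `max (j - i)`
equal `n`. The whiskers form a matching of size `n`; no matching is larger, since every edge has an
endpoint in `G`.

The Koszul complex is built as an iterated mapping cone (`cone`, `exists_resolution_whiskerIdeal`).
Since `HasProjDim` and `HasRegularity` speak of every minimal resolution, `exists_deg_eq` compares
any two of them. It matches only the sets of degrees that occur, not their multiplicities, and this
suffices for the two maxima. -/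

/-! ### Comparison of minimal graded free resolutions -/

section Comparison

variable {σ K : Type*} [Field K]

/-- The homogeneous part of degree `k` of a vector in the graded free module `⨁ₐ R(-δ a)`. -/
noncomputable def homogeneousPart {r : ℕ} (δ : Fin r → ℕ) (k : ℕ) :
    (Fin r → MvPolynomial σ K) →ₗ[K] (Fin r → MvPolynomial σ K) :=
  LinearMap.pi fun a =>
    -- Without the case split, truncated subtraction would pick out the constant term when `k < δ
    -- a`.
    (if δ a ≤ k then homogeneousComponent (k - δ a) else 0) ∘ₗ LinearMap.proj a

theorem coeff_homogeneousPart {r : ℕ} (δ : Fin r → ℕ) (k : ℕ) (v : Fin r → MvPolynomial σ K)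
    (a : Fin r) (m : σ →₀ ℕ) :
    coeff m (homogeneousPart δ k v a) = if m.degree + δ a = k then coeff m (v a) else 0 := by
  classical
  simp only [homogeneousPart, LinearMap.pi_apply, LinearMap.comp_apply, LinearMap.proj_apply]
  by_cases h : δ a ≤ k
  · rw [if_pos h, coeff_homogeneousComponent]
    congr 1
    apply propext
    omega
  · rw [if_neg h, if_neg (by omega)]
    simp

theorem isHomogeneousVector_homogeneousPart {r : ℕ} (δ : Fin r → ℕ) (k : ℕ)
    (v : Fin r → MvPolynomial σ K) : IsHomogeneousVector δ k (homogeneousPart δ k v) := by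
  intro a m hm
  rw [mem_support_iff, coeff_homogeneousPart] at hm
  by_contra h
  exact hm (if_neg h)

theorem IsHomogeneousVector.homogeneousPart_eq {r : ℕ} {δ : Fin r → ℕ} {k : ℕ}
    {v : Fin r → MvPolynomial σ K} (hv : IsHomogeneousVector δ k v) (l : ℕ) :
    homogeneousPart δ l v = if k = l then v else 0 := by
  ext a m
  rw [coeff_homogeneousPart]
  by_cases hm : m ∈ (v a).support
  · have := hv a m hm
    by_cases h : k = l <;> simp [h, this]
  · rw [notMem_support_iff] at hm
    split_ifs <;> simp [hm]

theorem IsHomogeneousVector.monomial_smul {r : ℕ} {δ : Fin r → ℕ} {k : ℕ}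
    {v : Fin r → MvPolynomial σ K} (hv : IsHomogeneousVector δ k v) (m : σ →₀ ℕ) (c : K) :
    IsHomogeneousVector δ (m.degree + k) (monomial m c • v) := by
  classical
  intro a l hl
  rw [mem_support_iff, Pi.smul_apply, smul_eq_mul, coeff_monomial_mul'] at hl
  split_ifs at hl with h
  · have := hv a (l - m) (mem_support_iff.2 (right_ne_zero_of_mul hl))
    have e : l.degree = m.degree + (l - m).degree := by
      rw [← map_add, add_tsub_cancel_of_le h]
    omega
  · exact absurd rfl hl

theorem isHomogeneousVector_single {r : ℕ} (δ : Fin r → ℕ) (b : Fin r) :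
    IsHomogeneousVector δ (δ b) (Pi.single b (1 : MvPolynomial σ K)) := by
  classical
  intro a m hm
  by_cases h : a = b
  · subst h
    rw [Pi.single_eq_same, mem_support_iff, coeff_one] at hm
    have : m = 0 := by
      by_contra h
      exact hm (if_neg (Ne.symm h))
    simp [this]
  · simp [h] at hm

/-- A homogeneous map of degree zero between graded free modules commutes with taking homogeneous
parts. -/
theorem map_homogeneousPart {r s : ℕ} {δ : Fin r → ℕ} {ε : Fin s → ℕ}
    (f : (Fin r → MvPolynomial σ K) →ₗ[MvPolynomial σ K] (Fin s → MvPolynomial σ K))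
    (hf : ∀ b, IsHomogeneousVector ε (δ b) (f (Pi.single b 1))) (k : ℕ)
    (v : Fin r → MvPolynomial σ K) :
    f (homogeneousPart δ k v) = homogeneousPart ε k (f v) := by
  -- Taking homogeneous parts is only `K`-linear, so the identity is checked on monomial multiples
  -- of basis vectors.
  suffices h : f.restrictScalars K ∘ₗ homogeneousPart δ k =
      homogeneousPart ε k ∘ₗ f.restrictScalars K from LinearMap.congr_fun h v
  refine LinearMap.pi_ext' fun b => ?_
  refine MvPolynomial.linearMap_ext fun m => LinearMap.ext fun c => ?_
  have e : Pi.single b (monomial m c) =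
      monomial m c • (Pi.single b 1 : Fin r → MvPolynomial σ K) := by
    rw [← Pi.single_smul, smul_eq_mul, mul_one]
  simp only [LinearMap.comp_apply, LinearMap.coe_restrictScalars, LinearMap.coe_single]
  rw [e, map_smul f, ((isHomogeneousVector_single δ b).monomial_smul m c).homogeneousPart_eq,
    ((hf b).monomial_smul m c).homogeneousPart_eq]
  split_ifs <;> simp

/-- Projecting a preimage to degree `k` does not change its image when that image is already
homogeneous of degree `k`. This makes lifts in the comparison homogeneous. -/
theorem exists_homogeneous_preimage {r s : ℕ} {δ : Fin r → ℕ} {ε : Fin s → ℕ}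
    (f : (Fin r → MvPolynomial σ K) →ₗ[MvPolynomial σ K] (Fin s → MvPolynomial σ K))
    (hf : ∀ b, IsHomogeneousVector ε (δ b) (f (Pi.single b 1))) {k : ℕ}
    {v : Fin r → MvPolynomial σ K} (hv : IsHomogeneousVector ε k (f v)) :
    ∃ w, IsHomogeneousVector δ k w ∧ f w = f v :=
  ⟨homogeneousPart δ k v, isHomogeneousVector_homogeneousPart δ k v, by
    rw [map_homogeneousPart f hf, hv.homogeneousPart_eq, if_pos rfl]⟩

/-- Homogeneous maps of degree zero preserve homogeneity. -/
theorem IsHomogeneousVector.map {r s : ℕ} {δ : Fin r → ℕ} {ε : Fin s → ℕ}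
    (f : (Fin r → MvPolynomial σ K) →ₗ[MvPolynomial σ K] (Fin s → MvPolynomial σ K))
    (hf : ∀ b, IsHomogeneousVector ε (δ b) (f (Pi.single b 1))) {k : ℕ}
    {v : Fin r → MvPolynomial σ K} (hv : IsHomogeneousVector δ k v) :
    IsHomogeneousVector ε k (f v) := by
  have h := map_homogeneousPart f hf k v
  rw [hv.homogeneousPart_eq, if_pos rfl] at h
  rw [h]
  exact isHomogeneousVector_homogeneousPart ε k _

theorem exists_linearMap_single {R M : Type*} [CommRing R] [AddCommGroup M] [Module R M] {r : ℕ}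
    (w : Fin r → M) : ∃ f : (Fin r → R) →ₗ[R] M, ∀ b, f (Pi.single b 1) = w b :=
  ⟨(Pi.basisFun R (Fin r)).constr R w, fun b => by
    simpa only [Pi.basisFun_apply] using (Pi.basisFun R (Fin r)).constr_basis R w b⟩

theorem linearMap_ext_single {R M : Type*} [CommRing R] [AddCommGroup M] [Module R M] {r : ℕ}
    {f g : (Fin r → R) →ₗ[R] M} (h : ∀ b, f (Pi.single b 1) = g (Pi.single b 1)) : f = g :=
  (Pi.basisFun R (Fin r)).ext fun b => by simpa using h b

theorem linearMap_apply_eq_sum {R M : Type*} [CommRing R] [AddCommGroup M] [Module R M] {r : ℕ}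
    (f : (Fin r → R) →ₗ[R] M) (v : Fin r → R) : f v = ∑ b, v b • f (Pi.single b 1) := by
  conv_lhs => rw [pi_eq_sum_univ' v]
  simp only [map_sum, map_smul]

theorem constantCoeff_linearMap_apply {r s : ℕ}
    (f : (Fin r → MvPolynomial σ K) →ₗ[MvPolynomial σ K] (Fin s → MvPolynomial σ K))
    {v : Fin r → MvPolynomial σ K} (hv : ∀ b, constantCoeff (v b) = 0) (a : Fin s) :
    constantCoeff (f v a) = 0 := by
  rw [linearMap_apply_eq_sum f v, Finset.sum_apply, map_sum]
  exact Finset.sum_eq_zero fun b _ => by simp [hv b]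

theorem constantCoeff_eq_zero_of_mem_span_X {p : MvPolynomial σ K}
    (hp : p ∈ Ideal.span (Set.range (X : σ → MvPolynomial σ K))) : constantCoeff p = 0 := by
  have : Ideal.span (Set.range (X : σ → MvPolynomial σ K)) ≤ RingHom.ker constantCoeff := by
    rw [Ideal.span_le]
    rintro _ ⟨i, rfl⟩
    simp
  exact this hp

namespace MinimalGradedFreeResolution

variable {I : Ideal (MvPolynomial σ K)}

/-- The quotient carries no explicit grading here, so the augmentation is lifted to a homogeneous
map into `R`; homogeneity of `I` lets the degree `k` part of a lift be taken modulo `I`. -/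
theorem exists_homogeneous_aug (F : MinimalGradedFreeResolution I)
    (hI : ∀ p ∈ I, ∀ k, homogeneousComponent k p ∈ I) {k : ℕ} {p : MvPolynomial σ K}
    (hp : p.IsHomogeneous k) :
    ∃ w, IsHomogeneousVector (F.deg 0) k w ∧ F.aug w = Ideal.Quotient.mk I p := by
  choose q hq hqa using F.aug_homogeneous
  obtain ⟨f, hf⟩ := exists_linearMap_single (R := MvPolynomial σ K)
    fun b => (fun _ => q b : Fin 1 → MvPolynomial σ K)
  have haug : ∀ v, F.aug v = Ideal.Quotient.mk I (f v 0) := by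
    intro v
    rw [linearMap_apply_eq_sum F.aug, linearMap_apply_eq_sum f, Finset.sum_apply, map_sum]
    refine Finset.sum_congr rfl fun b _ => ?_
    rw [hqa, hf, Pi.smul_apply, smul_eq_mul, map_mul]
    rfl
  have hfh : ∀ b, IsHomogeneousVector (fun _ : Fin 1 => 0) (F.deg 0 b) (f (Pi.single b 1)) := by
    intro b a m hm
    rw [hf, mem_support_iff] at hm
    simpa [Finsupp.degree_eq_weight_one, Pi.one_def] using hq b hm
  obtain ⟨v, hv⟩ := F.aug_surjective (Ideal.Quotient.mk I p)
  refine ⟨homogeneousPart (F.deg 0) k v, isHomogeneousVector_homogeneousPart _ _ _, ?_⟩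
  rw [haug] at hv ⊢
  rw [map_homogeneousPart f hfh, Ideal.Quotient.eq]
  rw [Ideal.Quotient.eq] at hv
  have := hI _ hv k
  rw [map_sub, homogeneousComponent_of_mem hp, if_pos rfl] at this
  simpa [homogeneousPart] using this

/-- Two minimal graded free resolutions have summands of the same degrees in each homological
degree. -/
theorem exists_deg_eq (F G : MinimalGradedFreeResolution I)
    (hI : ∀ p ∈ I, ∀ k, homogeneousComponent k p ∈ I) (i : ℕ) (b : Fin (F.rank i)) :
    ∃ a, G.deg i a = F.deg i b := by
  -- `φ` and `ψ` are comparison maps and `h` is a homotopy from the identity to `ψφ`. The homotopy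
  -- identity is recorded only on the image of `F.d i`, where the term with the preceding homotopy
  -- vanishes, so the induction carries data at a single index. Only `φ` has to be homogeneous.
  have key : ∀ i, ∃ (φ : (Fin (F.rank i) → MvPolynomial σ K) →ₗ[MvPolynomial σ K]
        (Fin (G.rank i) → MvPolynomial σ K))
      (ψ : (Fin (G.rank i) → MvPolynomial σ K) →ₗ[MvPolynomial σ K]
        (Fin (F.rank i) → MvPolynomial σ K))
      (h : (Fin (F.rank i) → MvPolynomial σ K) →ₗ[MvPolynomial σ K]
        (Fin (F.rank (i + 1)) → MvPolynomial σ K)),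
      (∀ b, IsHomogeneousVector (G.deg i) (F.deg i b) (φ (Pi.single b 1))) ∧
      (∀ v, ∃ w, G.d i w = φ (F.d i v)) ∧ (∀ v, ∃ w, F.d i w = ψ (G.d i v)) ∧
      (∀ v, F.d i (h (F.d i v)) = ψ (φ (F.d i v)) - F.d i v) ∧
      ∀ v a, constantCoeff ((ψ (φ v) - v - F.d i (h v)) a) = 0 := by
    intro i
    induction i with
    | zero =>
      have hφ : ∀ b, ∃ w, IsHomogeneousVector (G.deg 0) (F.deg 0 b) w ∧
          G.aug w = F.aug (Pi.single b 1) := by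
        intro b
        obtain ⟨p, hp, hpa⟩ := F.aug_homogeneous b
        rw [hpa]
        exact G.exists_homogeneous_aug hI hp
      choose u hu hua using hφ
      obtain ⟨φ, hφ⟩ := exists_linearMap_single (R := MvPolynomial σ K) u
      choose t ht using fun b => F.aug_surjective (G.aug (Pi.single b 1))
      obtain ⟨ψ, hψ⟩ := exists_linearMap_single (R := MvPolynomial σ K) t
      have e1 : ∀ v, G.aug (φ v) = F.aug v := LinearMap.congr_fun
        (f := G.aug ∘ₗ φ) (linearMap_ext_single fun b => by simp [hφ, hua])
      have e2 : ∀ v, F.aug (ψ v) = G.aug v := LinearMap.congr_fun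
        (f := F.aug ∘ₗ ψ) (linearMap_ext_single fun b => by simp [hψ, ht])
      have hh : ∀ v, ∃ w, F.d 0 w = ψ (φ v) - v := fun v =>
        (F.exact_zero _).1 (by rw [map_sub, e2, e1, sub_self])
      choose s hs using fun b => hh (Pi.single b 1)
      obtain ⟨h, hh⟩ := exists_linearMap_single (R := MvPolynomial σ K) s
      have e3 : ∀ v, F.d 0 (h v) = ψ (φ v) - v := LinearMap.congr_fun
        (f := F.d 0 ∘ₗ h) (g := ψ ∘ₗ φ - LinearMap.id)
        (linearMap_ext_single fun b => by simp [hh, hs])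
      refine ⟨φ, ψ, h, fun b => hφ b ▸ hu b, fun v => (G.exact_zero _).1 ?_,
        fun v => (F.exact_zero _).1 ?_, fun v => e3 _, fun v a => ?_⟩
      · rw [e1, F.exact_zero.apply_apply_eq_zero]
      · rw [e2, G.exact_zero.apply_apply_eq_zero]
      · rw [e3, sub_self]
        simp
    | succ i ih =>
      obtain ⟨φ₀, ψ₀, h₀, hφ₀, hφd, hψd, hhd, -⟩ := ih
      have hφ : ∀ b, ∃ w, IsHomogeneousVector (G.deg (i + 1)) (F.deg (i + 1) b) w ∧
          G.d i w = φ₀ (F.d i (Pi.single b 1)) := by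
        intro b
        obtain ⟨w, hw⟩ := hφd (Pi.single b 1)
        rw [← hw]
        refine exists_homogeneous_preimage (G.d i) (G.d_homogeneous i) ?_
        rw [hw]
        exact (F.d_homogeneous i b).map φ₀ hφ₀
      choose u hu hua using hφ
      obtain ⟨φ, hφ⟩ := exists_linearMap_single (R := MvPolynomial σ K) u
      choose t ht using fun b => hψd (Pi.single b 1)
      obtain ⟨ψ, hψ⟩ := exists_linearMap_single (R := MvPolynomial σ K) t
      have e1 : ∀ v, G.d i (φ v) = φ₀ (F.d i v) := LinearMap.congr_fun
        (f := G.d i ∘ₗ φ) (g := φ₀ ∘ₗ F.d i) (linearMap_ext_single fun b => by simp [hφ, hua])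
      have e2 : ∀ v, F.d i (ψ v) = ψ₀ (G.d i v) := LinearMap.congr_fun
        (f := F.d i ∘ₗ ψ) (g := ψ₀ ∘ₗ G.d i) (linearMap_ext_single fun b => by simp [hψ, ht])
      have hh : ∀ v, ∃ w, F.d (i + 1) w = ψ (φ v) - v - h₀ (F.d i v) := fun v =>
        (F.exact_succ i _).1 (by rw [map_sub, map_sub, e2, e1, hhd, sub_self])
      choose s hs using fun b => hh (Pi.single b 1)
      obtain ⟨h, hh⟩ := exists_linearMap_single (R := MvPolynomial σ K) s
      have e3 : ∀ v, F.d (i + 1) (h v) = ψ (φ v) - v - h₀ (F.d i v) := LinearMap.congr_fun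
        (f := F.d (i + 1) ∘ₗ h) (g := ψ ∘ₗ φ - LinearMap.id - h₀ ∘ₗ F.d i)
        (linearMap_ext_single fun b => by simp [hh, hs])
      refine ⟨φ, ψ, h, fun b => hφ b ▸ hu b, fun v => (G.exact_succ i _).1 ?_,
        fun v => (F.exact_succ i _).1 ?_, fun v => ?_, fun v a => ?_⟩
      · rw [e1, (F.exact_succ i).apply_apply_eq_zero, map_zero]
      · rw [e2, (G.exact_succ i).apply_apply_eq_zero, map_zero]
      · rw [e3, (F.exact_succ i).apply_apply_eq_zero, map_zero, sub_zero]
      -- What remains is `h₀ (F.d i v)`, and minimality puts `F.d i v` in `𝔪 F i`.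
      · rw [e3, sub_sub_cancel]
        exact constantCoeff_linearMap_apply h₀
          (fun b => constantCoeff_eq_zero_of_mem_span_X (F.minimal i v b)) a
  obtain ⟨φ, ψ, h, hφ, -, -, -, hcc⟩ := key i
  by_contra! hne
  -- A nonzero constant term in coordinate `a` would force `G.deg i a = F.deg i b`. Hence `φ` sends
  -- the basis vector into `𝔪 G i`, although `ψφ` is the identity modulo `𝔪`.
  have hz : ∀ a, constantCoeff (φ (Pi.single b 1) a) = 0 := by
    intro a
    by_contra ha
    refine hne a ?_
    simpa using hφ b a 0 (mem_support_iff.2 ha)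
  have h1 := hcc (Pi.single b 1) b
  have h2 := constantCoeff_eq_zero_of_mem_span_X (F.minimal i (h (Pi.single b 1)) b)
  have h3 := constantCoeff_linearMap_apply ψ hz b
  rw [Pi.sub_apply, Pi.sub_apply, map_sub, map_sub, h2, h3, Pi.single_eq_same, map_one] at h1
  norm_num at h1

theorem betti_ne_zero_iff (F : MinimalGradedFreeResolution I) (i j : ℕ) :
    F.betti i j ≠ 0 ↔ ∃ a, F.deg i a = j := by
  simp [betti, Finset.filter_eq_empty_iff]

end MinimalGradedFreeResolution

end Comparison

/-! ### Mapping cones of multiplication by a form -/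

section Cone

variable {σ K : Type*} [Field K]

/-- The free module on `m + n` generators as a product. -/
def splitEquiv (R : Type*) [CommRing R] (m n : ℕ) :
    (Fin (m + n) → R) ≃ₗ[R] (Fin m → R) × (Fin n → R) :=
  (LinearEquiv.funCongrLeft R R finSumFinEquiv).trans
    (LinearEquiv.sumArrowLequivProdArrow (Fin m) (Fin n) R R)

section splitEquiv

variable {R : Type*} [CommRing R] {m n : ℕ}

theorem splitEquiv_single_castAdd (b : Fin m) :
    splitEquiv R m n (Pi.single (Fin.castAdd n b) 1) = (Pi.single b 1, 0) := by
  ext a <;> simp [splitEquiv, LinearEquiv.funCongrLeft, Pi.single_apply, Fin.ext_iff]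
  omega

theorem splitEquiv_single_natAdd (b : Fin n) :
    splitEquiv R m n (Pi.single (Fin.natAdd m b) 1) = (0, Pi.single b 1) := by
  ext a <;> simp [splitEquiv, LinearEquiv.funCongrLeft, Pi.single_apply, Fin.ext_iff]
  omega

theorem splitEquiv_symm_castAdd (p : (Fin m → R) × (Fin n → R)) (a : Fin m) :
    (splitEquiv R m n).symm p (Fin.castAdd n a) = p.1 a := by
  obtain ⟨v, rfl⟩ := (splitEquiv R m n).surjective p
  simp [splitEquiv, LinearEquiv.funCongrLeft]

theorem splitEquiv_symm_natAdd (p : (Fin m → R) × (Fin n → R)) (a : Fin n) :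
    (splitEquiv R m n).symm p (Fin.natAdd m a) = p.2 a := by
  obtain ⟨v, rfl⟩ := (splitEquiv R m n).surjective p
  simp [splitEquiv, LinearEquiv.funCongrLeft]

end splitEquiv

theorem IsHomogeneousVector.smul {r : ℕ} {δ : Fin r → ℕ} {k e : ℕ} {f : MvPolynomial σ K}
    {v : Fin r → MvPolynomial σ K} (hf : f.IsHomogeneous e) (hv : IsHomogeneousVector δ k v) :
    IsHomogeneousVector δ (k + e) (f • v) := by
  classical
  intro a m hm
  obtain ⟨s, hs, t, ht, rfl⟩ := Finset.mem_add.1 (support_mul _ _ hm)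
  have h1 := hv a t ht
  have h2 : s.degree = e := by
    simpa [Finsupp.degree_eq_weight_one, Pi.one_def] using hf (mem_support_iff.1 hs)
  rw [map_add]
  omega

theorem IsHomogeneousVector.neg {r : ℕ} {δ : Fin r → ℕ} {k : ℕ}
    {v : Fin r → MvPolynomial σ K} (hv : IsHomogeneousVector δ k v) :
    IsHomogeneousVector δ k (-v) := by
  intro a m hm
  rw [Pi.neg_apply, support_neg] at hm
  exact hv a m hm

theorem IsHomogeneousVector.zero {r : ℕ} (δ : Fin r → ℕ) (k : ℕ) :
    IsHomogeneousVector δ k (0 : Fin r → MvPolynomial σ K) := by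
  intro a m hm
  simp at hm

theorem IsHomogeneousVector.splitEquiv_symm {m n : ℕ} {δ : Fin m → ℕ} {ε : Fin n → ℕ} {k : ℕ}
    {u : Fin m → MvPolynomial σ K} {w : Fin n → MvPolynomial σ K}
    (hu : IsHomogeneousVector δ k u) (hw : IsHomogeneousVector ε k w) :
    IsHomogeneousVector (Fin.append δ ε) k ((splitEquiv _ m n).symm (u, w)) := by
  intro a
  refine Fin.addCases (fun a => ?_) (fun a => ?_) a
  · rw [splitEquiv_symm_castAdd, Fin.append_left]
    exact hu a
  · rw [splitEquiv_symm_natAdd, Fin.append_right]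
    exact hw a

namespace MinimalGradedFreeResolution

variable {I : Ideal (MvPolynomial σ K)}

/-- The first differential of the mapping cone of multiplication by `f`. -/
noncomputable def coneDZero (F : MinimalGradedFreeResolution I) (f : MvPolynomial σ K) :
    (Fin (F.rank 1 + F.rank 0) → MvPolynomial σ K) →ₗ[MvPolynomial σ K]
      (Fin (F.rank 0) → MvPolynomial σ K) :=
  ((F.d 0).coprod (f • LinearMap.id)) ∘ₗ (splitEquiv _ (F.rank 1) (F.rank 0)).toLinearMap

/-- The higher differentials of the mapping cone of multiplication by `f`. -/
noncomputable def coneDSucc (F : MinimalGradedFreeResolution I) (f : MvPolynomial σ K) (i : ℕ) :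
    (Fin (F.rank (i + 2) + F.rank (i + 1)) → MvPolynomial σ K) →ₗ[MvPolynomial σ K]
      (Fin (F.rank (i + 1) + F.rank i) → MvPolynomial σ K) :=
  (splitEquiv _ (F.rank (i + 1)) (F.rank i)).symm.toLinearMap ∘ₗ
    -- The sign cancels the two terms `f • d w` in the composite of consecutive differentials.
    (((F.d (i + 1)).coprod (f • LinearMap.id)).prod (-(F.d i ∘ₗ LinearMap.snd _ _ _))) ∘ₗ
    (splitEquiv _ (F.rank (i + 2)) (F.rank (i + 1))).toLinearMap

/-- The augmentation of the mapping cone of multiplication by `f`. -/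
noncomputable def coneAug (F : MinimalGradedFreeResolution I) (f : MvPolynomial σ K) :
    (Fin (F.rank 0) → MvPolynomial σ K) →ₗ[MvPolynomial σ K]
      (MvPolynomial σ K ⧸ (I ⊔ Ideal.span {f})) :=
  (Submodule.factor le_sup_left) ∘ₗ F.aug

theorem coneDZero_apply (F : MinimalGradedFreeResolution I) (f : MvPolynomial σ K)
    (v : Fin (F.rank 1 + F.rank 0) → MvPolynomial σ K) :
    F.coneDZero f v = F.d 0 (splitEquiv _ _ _ v).1 + f • (splitEquiv _ _ _ v).2 := rfl

theorem coneDSucc_apply (F : MinimalGradedFreeResolution I) (f : MvPolynomial σ K) (i : ℕ)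
    (v : Fin (F.rank (i + 2) + F.rank (i + 1)) → MvPolynomial σ K) :
    F.coneDSucc f i v = (splitEquiv _ (F.rank (i + 1)) (F.rank i)).symm
      (F.d (i + 1) (splitEquiv _ _ _ v).1 + f • (splitEquiv _ _ _ v).2,
        -F.d i (splitEquiv _ _ _ v).2) := rfl

theorem coneAug_eq_mk (F : MinimalGradedFreeResolution I) (f : MvPolynomial σ K)
    {v : Fin (F.rank 0) → MvPolynomial σ K} {p : MvPolynomial σ K}
    (h : F.aug v = Ideal.Quotient.mk I p) : F.coneAug f v = Ideal.Quotient.mk _ p := by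
  rw [coneAug, LinearMap.comp_apply, h]
  rfl

theorem coneDZero_homogeneous (F : MinimalGradedFreeResolution I) {f : MvPolynomial σ K} {e : ℕ}
    (hf : f.IsHomogeneous e) (b : Fin (F.rank 1 + F.rank 0)) :
    IsHomogeneousVector (F.deg 0) (Fin.append (F.deg 1) (fun a => F.deg 0 a + e) b)
      (F.coneDZero f (Pi.single b 1)) := by
  refine Fin.addCases (fun b => ?_) (fun b => ?_) b
  · rw [coneDZero_apply, splitEquiv_single_castAdd]
    simp only [Fin.append_left, smul_zero, add_zero]
    exact F.d_homogeneous 0 b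
  · rw [coneDZero_apply, splitEquiv_single_natAdd]
    simp only [Fin.append_right, map_zero, zero_add]
    exact (isHomogeneousVector_single _ b).smul hf

theorem coneDSucc_homogeneous (F : MinimalGradedFreeResolution I) {f : MvPolynomial σ K} {e : ℕ}
    (hf : f.IsHomogeneous e) (i : ℕ) (b : Fin (F.rank (i + 2) + F.rank (i + 1))) :
    IsHomogeneousVector (Fin.append (F.deg (i + 1)) (fun a => F.deg i a + e))
      (Fin.append (F.deg (i + 2)) (fun a => F.deg (i + 1) a + e) b)
      (F.coneDSucc f i (Pi.single b 1)) := by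
  refine Fin.addCases (fun b => ?_) (fun b => ?_) b
  · rw [coneDSucc_apply, splitEquiv_single_castAdd]
    simp only [Fin.append_left, smul_zero, add_zero, map_zero, neg_zero]
    exact (F.d_homogeneous (i + 1) b).splitEquiv_symm (.zero _ _)
  · rw [coneDSucc_apply, splitEquiv_single_natAdd]
    simp only [Fin.append_right, map_zero, zero_add]
    refine ((isHomogeneousVector_single _ b).smul hf).splitEquiv_symm ?_
    intro a m hm
    have := (F.d_homogeneous i b).neg a m hm
    dsimp only
    omega

theorem exact_coneDZero_coneAug (F : MinimalGradedFreeResolution I) (f : MvPolynomial σ K) :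
    Function.Exact (F.coneDZero f) (F.coneAug f) := by
  intro v
  constructor
  · intro hv
    obtain ⟨p, hp⟩ := Ideal.Quotient.mk_surjective (F.aug v)
    rw [F.coneAug_eq_mk f hp.symm, Ideal.Quotient.eq_zero_iff_mem] at hv
    obtain ⟨a, ha, b, hb, rfl⟩ := Submodule.mem_sup.1 hv
    obtain ⟨c, rfl⟩ := Ideal.mem_span_singleton'.1 hb
    obtain ⟨w, hw⟩ := F.aug_surjective (Ideal.Quotient.mk I c)
    have hz : F.aug (v - f • w) = 0 := by
      rw [map_sub, map_smul, hw, ← hp, map_add, Ideal.Quotient.eq_zero_iff_mem.2 ha, zero_add,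
        mul_comm, map_mul, sub_eq_zero]
      rfl
    obtain ⟨u, hu⟩ := (F.exact_zero _).1 hz
    refine ⟨(splitEquiv _ _ _).symm (u, w), ?_⟩
    rw [coneDZero_apply, LinearEquiv.apply_symm_apply, hu]
    exact sub_add_cancel _ _
  · rintro ⟨w, rfl⟩
    obtain ⟨p, hp⟩ := Ideal.Quotient.mk_surjective (F.aug (splitEquiv _ _ _ w).2)
    have h : F.aug (F.coneDZero f w) = Ideal.Quotient.mk I (f * p) := by
      rw [coneDZero_apply, map_add, map_smul, F.exact_zero.apply_apply_eq_zero, zero_add, ← hp]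
      rfl
    rw [F.coneAug_eq_mk f h]
    exact Ideal.Quotient.eq_zero_iff_mem.2
      (Ideal.mem_sup_right (Ideal.mul_mem_right p _ (Ideal.mem_span_singleton_self f)))

/-- The one spot where regularity of `f` enters exactness: from `d u + f w = 0` the augmentation
gives `f · aug w = 0`, so `aug w = 0` and `w = d t`. Then `u + f t` is a cycle, say `d s`, and `(s,
-t)` is the preimage. -/
theorem exact_coneDSucc_coneDZero (F : MinimalGradedFreeResolution I) {f : MvPolynomial σ K}
    (hreg : ∀ p, f * p ∈ I → p ∈ I) : Function.Exact (F.coneDSucc f 0) (F.coneDZero f) := by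
  intro v
  constructor
  · intro hv
    obtain ⟨⟨u, w⟩, rfl⟩ := (splitEquiv _ _ _).symm.surjective v
    rw [coneDZero_apply, LinearEquiv.apply_symm_apply] at hv
    dsimp only at hv
    have hw : F.aug w = 0 := by
      obtain ⟨p, hp⟩ := Ideal.Quotient.mk_surjective (F.aug w)
      have h := congrArg F.aug hv
      rw [map_add, F.exact_zero.apply_apply_eq_zero, zero_add, map_smul, ← hp, map_zero] at h
      rw [← hp]
      exact Ideal.Quotient.eq_zero_iff_mem.2 (hreg p (Ideal.Quotient.eq_zero_iff_mem.1 h))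
    obtain ⟨t, ht⟩ := (F.exact_zero w).1 hw
    have hz : F.d 0 (u + f • t) = 0 := by rw [map_add, map_smul, ht, hv]
    obtain ⟨s, hs⟩ := (F.exact_succ 0 _).1 hz
    refine ⟨(splitEquiv _ _ _).symm (s, -t), ?_⟩
    rw [coneDSucc_apply, LinearEquiv.apply_symm_apply]
    simp only [hs, smul_neg, add_neg_cancel_right, map_neg, neg_neg, ht]
  · rintro ⟨w, rfl⟩
    rw [coneDSucc_apply, coneDZero_apply, LinearEquiv.apply_symm_apply]
    simp only [map_add, map_smul, (F.exact_succ 0).apply_apply_eq_zero, smul_neg, zero_add]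
    exact add_neg_cancel _

/-- Here `d w = 0` is read off the second component, so no regularity is needed. -/
theorem exact_coneDSucc (F : MinimalGradedFreeResolution I) (f : MvPolynomial σ K) (i : ℕ) :
    Function.Exact (F.coneDSucc f (i + 1)) (F.coneDSucc f i) := by
  intro v
  constructor
  · intro hv
    rw [coneDSucc_apply] at hv
    obtain ⟨⟨u, w⟩, rfl⟩ := (splitEquiv _ _ _).symm.surjective v
    rw [LinearEquiv.apply_symm_apply] at hv
    replace hv := (LinearEquiv.map_eq_zero_iff _).1 hv
    rw [Prod.mk_eq_zero, neg_eq_zero] at hv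
    obtain ⟨hv, hw⟩ := hv
    obtain ⟨t, ht⟩ := (F.exact_succ i w).1 hw
    have hz : F.d (i + 1) (u + f • t) = 0 := by rw [map_add, map_smul, ht, hv]
    obtain ⟨s, hs⟩ := (F.exact_succ (i + 1) _).1 hz
    refine ⟨(splitEquiv _ _ _).symm (s, -t), ?_⟩
    rw [coneDSucc_apply, LinearEquiv.apply_symm_apply]
    simp only [hs, smul_neg, add_neg_cancel_right, map_neg, neg_neg, ht]
  · rintro ⟨w, rfl⟩
    rw [coneDSucc_apply, coneDSucc_apply, LinearEquiv.apply_symm_apply]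
    refine (LinearEquiv.map_eq_zero_iff _).2 ?_
    simp only [map_add, map_smul, map_neg, (F.exact_succ _).apply_apply_eq_zero, smul_neg,
      zero_add, neg_zero, Prod.mk_eq_zero, and_true]
    exact add_neg_cancel _

theorem coneDZero_minimal (F : MinimalGradedFreeResolution I) {f : MvPolynomial σ K}
    (hf : f ∈ Ideal.span (Set.range (X : σ → MvPolynomial σ K)))
    (v : Fin (F.rank 1 + F.rank 0) → MvPolynomial σ K) (a : Fin (F.rank 0)) :
    F.coneDZero f v a ∈ Ideal.span (Set.range (X : σ → MvPolynomial σ K)) := by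
  rw [coneDZero_apply]
  exact add_mem (F.minimal 0 _ a) (Ideal.mul_mem_right _ _ hf)

theorem coneDSucc_minimal (F : MinimalGradedFreeResolution I) {f : MvPolynomial σ K}
    (hf : f ∈ Ideal.span (Set.range (X : σ → MvPolynomial σ K))) (i : ℕ)
    (v : Fin (F.rank (i + 2) + F.rank (i + 1)) → MvPolynomial σ K)
    (a : Fin (F.rank (i + 1) + F.rank i)) :
    F.coneDSucc f i v a ∈ Ideal.span (Set.range (X : σ → MvPolynomial σ K)) := by
  rw [coneDSucc_apply]
  refine Fin.addCases (fun a => ?_) (fun a => ?_) a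
  · rw [splitEquiv_symm_castAdd]
    exact add_mem (F.minimal (i + 1) _ a) (Ideal.mul_mem_right _ _ hf)
  · rw [splitEquiv_symm_natAdd]
    exact neg_mem (F.minimal i _ a)

/-- The ranks in the mapping cone of multiplication by an element. -/
def coneRank (F : MinimalGradedFreeResolution I) : ℕ → ℕ
  | 0 => F.rank 0
  | i + 1 => F.rank (i + 1) + F.rank i

/-- The degrees in the mapping cone of multiplication by a form of degree `e`. -/
def coneDeg (F : MinimalGradedFreeResolution I) (e : ℕ) : ∀ i, Fin (F.coneRank i) → ℕ
  | 0 => F.deg 0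
  | i + 1 => Fin.append (F.deg (i + 1)) (fun a => F.deg i a + e)

/-- The differential of the mapping cone of multiplication by `f`. -/
noncomputable def coneD (F : MinimalGradedFreeResolution I) (f : MvPolynomial σ K) :
    ∀ i, (Fin (F.coneRank (i + 1)) → MvPolynomial σ K) →ₗ[MvPolynomial σ K]
      (Fin (F.coneRank i) → MvPolynomial σ K)
  | 0 => F.coneDZero f
  | i + 1 => F.coneDSucc f i

/-- If the form `f` in the ideal of the variables is a nonzerodivisor modulo `I`, then the mapping
cone of multiplication by `f` on a minimal resolution of `R ⧸ I` is a minimal resolution of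
`R ⧸ (I + (f))`. -/
noncomputable def cone (F : MinimalGradedFreeResolution I) {f : MvPolynomial σ K} {e : ℕ}
    (hf : f.IsHomogeneous e) (hfm : f ∈ Ideal.span (Set.range (X : σ → MvPolynomial σ K)))
    (hreg : ∀ p, f * p ∈ I → p ∈ I) : MinimalGradedFreeResolution (I ⊔ Ideal.span {f}) where
  rank := F.coneRank
  deg := F.coneDeg e
  d := F.coneD f
  aug := F.coneAug f
  d_homogeneous
    | 0 => F.coneDZero_homogeneous hf
    | i + 1 => F.coneDSucc_homogeneous hf i
  aug_homogeneous b := by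
    obtain ⟨p, hp, hpa⟩ := F.aug_homogeneous b
    exact ⟨p, hp, F.coneAug_eq_mk f hpa⟩
  aug_surjective := (Submodule.factor_surjective le_sup_left).comp F.aug_surjective
  exact_zero := F.exact_coneDZero_coneAug f
  exact_succ
    | 0 => F.exact_coneDSucc_coneDZero hreg
    | i + 1 => F.exact_coneDSucc f i
  minimal
    | 0 => F.coneDZero_minimal hfm
    | i + 1 => F.coneDSucc_minimal hfm i

/-- The resolution of `R ⧸ 0` by `R` itself. -/
noncomputable def bot : MinimalGradedFreeResolution (⊥ : Ideal (MvPolynomial σ K)) where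
  rank i := if i = 0 then 1 else 0
  deg _ _ := 0
  d _ := 0
  aug := (Submodule.mkQ _) ∘ₗ LinearMap.proj (⟨0, by simp⟩ : Fin (if 0 = 0 then 1 else 0))
  d_homogeneous _ _ := IsHomogeneousVector.zero _ _
  aug_homogeneous b := by
    refine ⟨1, isHomogeneous_one _ _, ?_⟩
    have hb : b = ⟨0, by simp⟩ := by
      exact Fin.ext (Nat.lt_one_iff.1 (b.2.trans_eq (if_pos rfl)))
    subst hb
    rw [LinearMap.comp_apply, LinearMap.proj_apply, Pi.single_eq_same]
    rfl
  aug_surjective := (Submodule.mkQ_surjective _).comp fun p => ⟨fun _ => p, rfl⟩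
  exact_zero := by
    intro v
    constructor
    · intro hv
      refine ⟨0, ?_⟩
      have h : v ⟨0, by simp⟩ = 0 := by
        simpa [Ideal.Quotient.eq_zero_iff_mem] using hv
      ext1 b
      have hb : b = ⟨0, by simp⟩ := by
        exact Fin.ext (Nat.lt_one_iff.1 (b.2.trans_eq (if_pos rfl)))
      subst hb
      exact h.symm
    · rintro ⟨w, rfl⟩
      simp
  exact_succ i := by
    intro v
    refine ⟨fun _ => ⟨0, ?_⟩, fun _ => rfl⟩
    ext1 b
    exact absurd b.2 (by simp)
  minimal _ _ _ := Submodule.zero_mem _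

end MinimalGradedFreeResolution

end Cone

/-! ### Neighbourhoods and matchings of the whiskered graph -/

namespace SimpleGraph

variable {V : Type*} (G : SimpleGraph V)

theorem whiskered_adj_inl_inr {u v : V} : 
    G.whiskered.Adj (Sum.inl u) (Sum.inr v) ↔ u = v := Iff.rfl

theorem whiskered_adj_inr_inl {u v : V} : G.whiskered.Adj (Sum.inr u) (Sum.inl v) ↔ u = v := Iff.rfl

theorem not_whiskered_adj_inr_inr {u v : V} : ¬ G.whiskered.Adj (Sum.inr u) (Sum.inr v) := id

/-- Every closed neighbourhood contains some pair `{x_v, y_v}`, and that of the leaf `y_v` is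
exactly this pair. -/
theorem closedNbhdIdeal_whiskered [Finite V] (K : Type*) [Field K] :
    G.whiskered.closedNbhdIdeal K = Ideal.span (Set.range fun v : V =>
      (X (Sum.inl v) * X (Sum.inr v) : MvPolynomial (V ⊕ V) K)) := by
  classical
  refine le_antisymm (Ideal.span_le.2 ?_) (Ideal.span_le.2 ?_)
  · rintro _ ⟨w, rfl⟩
    obtain ⟨v, h1, h2⟩ : ∃ v : V, Sum.inl v ∈ insert w (G.whiskered.neighborSet w) ∧
        Sum.inr v ∈ insert w (G.whiskered.neighborSet w) := by
      rcases w with v | v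
      · exact ⟨v, Or.inl rfl, Or.inr ((G.whiskered_adj_inl_inr).2 rfl)⟩
      · exact ⟨v, Or.inr ((G.whiskered_adj_inr_inl).2 rfl), Or.inl rfl⟩
    have hsub : ({Sum.inl v, Sum.inr v} : Finset (V ⊕ V)) ⊆
        (insert w (G.whiskered.neighborSet w)).toFinite.toFinset := by
      intro x hx
      rw [Set.Finite.mem_toFinset]
      rcases Finset.mem_insert.1 hx with rfl | hx
      · exact h1
      · rwa [Finset.mem_singleton.1 hx]
    refine Ideal.mem_of_dvd _ ?_ (Ideal.subset_span ⟨v, rfl⟩)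
    have := Finset.prod_dvd_prod_of_subset _ _ (X : V ⊕ V → MvPolynomial (V ⊕ V) K) hsub
    rwa [Finset.prod_pair (by simp)] at this
  · rintro _ ⟨v, rfl⟩
    refine Ideal.subset_span ⟨Sum.inr v, ?_⟩
    have : (insert (Sum.inr v) (G.whiskered.neighborSet (Sum.inr v))).toFinite.toFinset =
        {Sum.inl v, Sum.inr v} := by
      ext (x | x)
      · simp [whiskered_adj_inr_inl, eq_comm]
      · simp [not_whiskered_adj_inr_inr]
    rw [closedNbhdMonomial, this, Finset.prod_pair (by simp)]

/-- The matching formed by the whiskers. -/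
def whiskerSubgraph : G.whiskered.Subgraph where
  verts := Set.univ
  Adj
    | Sum.inl u, Sum.inr v => u = v
    | Sum.inr u, Sum.inl v => u = v
    | _, _ => False
  adj_sub := by
    rintro (u | u) (v | v) h
    · exact h.elim
    · exact h
    · exact h
    · exact h.elim
  edge_vert _ := trivial
  symm := ⟨by
    rintro (u | u) (v | v) h
    · exact h
    · exact Eq.symm h
    · exact Eq.symm h
    · exact h⟩

theorem isMatching_whiskerSubgraph : G.whiskerSubgraph.IsMatching := by
  rintro (v | v) -
  · refine ⟨Sum.inr v, rfl, ?_⟩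
    rintro (w | w) h
    · exact h.elim
    · exact congrArg Sum.inr (Eq.symm h)
  · refine ⟨Sum.inl v, rfl, ?_⟩
    rintro (w | w) h
    · exact congrArg Sum.inl (Eq.symm h)
    · exact h.elim

theorem edgeSet_whiskerSubgraph :
    G.whiskerSubgraph.edgeSet = Set.range fun v : V => s(Sum.inl v, Sum.inr v) := by
  ext e
  induction e with | _ x y
  rw [Subgraph.mem_edgeSet, Set.mem_range]
  constructor
  · rcases x with u | u <;> rcases y with v | v <;> intro h
    · exact h.elim
    · exact ⟨u, by rw [show u = v from h]⟩
    · exact ⟨u, by rw [show u = v from h, Sym2.eq_swap]⟩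
    · exact h.elim
  · rintro ⟨v, hv⟩
    rcases Sym2.eq_iff.1 hv with ⟨rfl, rfl⟩ | ⟨rfl, rfl⟩
    · exact rfl
    · exact rfl

theorem ncard_edgeSet_whiskerSubgraph : G.whiskerSubgraph.edgeSet.ncard = Nat.card V := by
  rw [edgeSet_whiskerSubgraph, ← Set.image_univ, Set.ncard_image_of_injective, Set.ncard_univ]
  intro u v h
  simpa using h

/-- Leaves are pairwise nonadjacent, so each edge has an old endpoint; in a matching that endpoint
determines the edge. -/
theorem Subgraph.IsMatching.ncard_edgeSet_le_of_whiskered [Finite V] {M : G.whiskered.Subgraph}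
    (hM : M.IsMatching) : M.edgeSet.ncard ≤ Nat.card V := by
  have h : ∀ e ∈ M.edgeSet, ∃ v : V, Sum.inl v ∈ e := by
    intro e he
    induction e with | _ x y
    have := M.adj_sub he
    rcases x with u | u
    · exact ⟨u, Sym2.mem_mk_left _ _⟩
    rcases y with v | v
    · exact ⟨v, Sym2.mem_mk_right _ _⟩
    · exact (G.not_whiskered_adj_inr_inr this).elim
  choose f hf using fun e : M.edgeSet => h e e.2
  have hinj : Function.Injective f := by
    rintro e₁ e₂ he
    obtain ⟨w₁, h₁⟩ := hf e₁
    obtain ⟨w₂, h₂⟩ := hf e₂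
    have a₁ : M.Adj (Sum.inl (f e₁)) w₁ := by
      rw [← Subgraph.mem_edgeSet, ← h₁]
      exact e₁.2
    have a₂ : M.Adj (Sum.inl (f e₂)) w₂ := by
      rw [← Subgraph.mem_edgeSet, ← h₂]
      exact e₂.2
    rw [← he] at a₂ h₂
    have := hM.eq_of_adj_left a₁ a₂
    ext1
    rw [h₁, h₂, this]
  exact Nat.card_le_card_of_injective f hinj

theorem matchingNumber_whiskered [Finite V] : G.whiskered.matchingNumber = Nat.card V := by
  refine IsGreatest.csSup_eq ⟨⟨_, G.isMatching_whiskerSubgraph, G.ncard_edgeSet_whiskerSubgraph⟩, ?_⟩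
  rintro _ ⟨M, hM, rfl⟩
  exact hM.ncard_edgeSet_le_of_whiskered

end SimpleGraph

/-! ### The Koszul resolution of the ideal of whiskers -/

section WhiskerIdeal

variable {V K : Type*} [Field K]

/-- The exponent of the monomial `x_v y_v`. -/
noncomputable def whiskerExponent (v : V) : V ⊕ V →₀ ℕ :=
  Finsupp.single (Sum.inl v) 1 + Finsupp.single (Sum.inr v) 1

theorem monomial_whiskerExponent (v : V) :
    monomial (whiskerExponent v) (1 : K) = X (Sum.inl v) * X (Sum.inr v) := by
  rw [X, X, monomial_mul, mul_one, whiskerExponent]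

theorem whiskerExponent_le_iff {v : V} {m : V ⊕ V →₀ ℕ} :
    whiskerExponent v ≤ m ↔ 1 ≤ m (Sum.inl v) ∧ 1 ≤ m (Sum.inr v) := by
  classical
  constructor
  · intro h
    exact ⟨by simpa [whiskerExponent] using h (Sum.inl v),
      by simpa [whiskerExponent] using h (Sum.inr v)⟩
  · rintro ⟨h1, h2⟩ (w | w)
    · by_cases h : v = w
      · subst h; simpa [whiskerExponent] using h1
      · simp [whiskerExponent, h]
    · by_cases h : v = w
      · subst h; simpa [whiskerExponent] using h2
      · simp [whiskerExponent, h]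

/-- The ideal generated by the monomials `x_v y_v` with `v ∈ S`. -/
noncomputable def whiskerIdeal (K : Type*) [Field K] (S : Set V) : Ideal (MvPolynomial (V ⊕ V) K) :=
  Ideal.span ((fun v : V => X (Sum.inl v) * X (Sum.inr v)) '' S)

theorem mem_whiskerIdeal {S : Set V} {p : MvPolynomial (V ⊕ V) K} :
    p ∈ whiskerIdeal K S ↔
      ∀ m ∈ p.support, ∃ v ∈ S, 1 ≤ m (Sum.inl v) ∧ 1 ≤ m (Sum.inr v) := by
  have : whiskerIdeal K S =
      Ideal.span ((fun m => monomial m (1 : K)) '' (whiskerExponent '' S)) := by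
    rw [whiskerIdeal, Set.image_image]
    simp only [monomial_whiskerExponent]
  rw [this, mem_ideal_span_monomial_image]
  simp only [Set.exists_mem_image, whiskerExponent_le_iff]

theorem homogeneousComponent_mem_whiskerIdeal {S : Set V} {p : MvPolynomial (V ⊕ V) K}
    (hp : p ∈ whiskerIdeal K S) (k : ℕ) : homogeneousComponent k p ∈ whiskerIdeal K S := by
  classical
  rw [mem_whiskerIdeal] at hp ⊢
  intro m hm
  refine hp m ?_
  rw [mem_support_iff, coeff_homogeneousComponent] at hm
  rw [mem_support_iff]
  intro h
  simp [h] at hm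

/-- Multiplication by `x_v y_v` changes exponents only at `v`, so divisibility of a monomial by `x_w
y_w` with `w ≠ v` is unaffected. -/
theorem mem_whiskerIdeal_of_mul_mem {S : Set V} {v : V} (hv : v ∉ S)
    {p : MvPolynomial (V ⊕ V) K} (hp : X (Sum.inl v) * X (Sum.inr v) * p ∈ whiskerIdeal K S) :
    p ∈ whiskerIdeal K S := by
  rw [← monomial_whiskerExponent, mem_whiskerIdeal] at hp
  rw [mem_whiskerIdeal]
  intro m hm
  obtain ⟨w, hw, h1, h2⟩ := hp (whiskerExponent v + m) (by
    rw [mem_support_iff, coeff_monomial_mul, one_mul]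
    exact mem_support_iff.1 hm)
  have hne : v ≠ w := fun h => hv (h ▸ hw)
  refine ⟨w, hw, ?_, ?_⟩
  · simpa [whiskerExponent, hne] using h1
  · simpa [whiskerExponent, hne] using h2

/-- Each new generator adds a copy of the previous resolution moved up one step and twisted by 2;
the ranks then follow Pascal's rule. -/
theorem exists_resolution_whiskerIdeal (S : Finset V) :
    ∃ F : MinimalGradedFreeResolution (whiskerIdeal K (S : Set V)),
      (∀ i a, F.deg i a = 2 * i) ∧ ∀ i, F.rank i = S.card.choose i := by
  classical
  induction S using Finset.induction_on with
  | empty =>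
    have : whiskerIdeal K ((∅ : Finset V) : Set V) = ⊥ := by simp [whiskerIdeal]
    rw [this]
    refine ⟨.bot, fun i a => ?_, fun i => ?_⟩
    · have h : 0 < if i = 0 then 1 else 0 := a.pos
      have hi : i = 0 := by
        by_contra hi
        simp [hi] at h
      simp [hi, MinimalGradedFreeResolution.bot]
    · cases i <;> simp [MinimalGradedFreeResolution.bot]
  | insert v S hv ih =>
    obtain ⟨F, hdeg, hrank⟩ := ih
    have : whiskerIdeal K ((insert v S : Finset V) : Set V) =
        whiskerIdeal K (S : Set V) ⊔ Ideal.span {X (Sum.inl v) * X (Sum.inr v)} := by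
      rw [whiskerIdeal, Finset.coe_insert, Set.image_insert_eq, Ideal.span_insert, sup_comm]
      rfl
    rw [this]
    refine ⟨F.cone (e := 2) ((isHomogeneous_X _ _).mul (isHomogeneous_X _ _))
      (Ideal.mul_mem_right _ _ (Ideal.subset_span ⟨_, rfl⟩))
      (fun p => mem_whiskerIdeal_of_mul_mem hv), ?_, ?_⟩
    · rintro (_ | i) a
      · exact hdeg 0 a
      · refine Fin.addCases (fun a => ?_) (fun a => ?_) a
        · change Fin.append (F.deg (i + 1)) (fun a => F.deg i a + 2) (Fin.castAdd _ a) = _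
          rw [Fin.append_left, hdeg]
        · change Fin.append (F.deg (i + 1)) (fun a => F.deg i a + 2) (Fin.natAdd _ a) = _
          rw [Fin.append_right, hdeg]
          ring
    · rintro (_ | i)
      · exact (hrank 0).trans (by simp)
      · change F.rank (i + 1) + F.rank i = _
        rw [hrank, hrank, Finset.card_insert_of_notMem hv, Nat.choose_succ_succ, add_comm]

/-- The comparison with the Koszul resolution is applied in both directions, once for each
implication. -/
theorem betti_whiskerIdeal_ne_zero_iff {S : Finset V}
    (F : MinimalGradedFreeResolution (whiskerIdeal K (S : Set V))) (i j : ℕ) :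
    F.betti i j ≠ 0 ↔ i ≤ S.card ∧ j = 2 * i := by
  obtain ⟨G, hdeg, hrank⟩ := exists_resolution_whiskerIdeal (K := K) S
  have hI : ∀ p ∈ whiskerIdeal K (S : Set V), ∀ k, homogeneousComponent k p ∈ _ :=
    fun p hp k => homogeneousComponent_mem_whiskerIdeal hp k
  rw [F.betti_ne_zero_iff]
  constructor
  · rintro ⟨a, rfl⟩
    obtain ⟨b, hb⟩ := F.exists_deg_eq G hI i a
    refine ⟨?_, by rw [← hb, hdeg]⟩
    by_contra h
    have := b.pos
    rw [hrank, Nat.choose_eq_zero_of_lt (not_le.1 h)] at this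
    exact absurd this (lt_irrefl 0)
  · rintro ⟨h, rfl⟩
    obtain ⟨a, ha⟩ := G.exists_deg_eq F hI i ⟨0, by rw [hrank]; exact Nat.choose_pos h⟩
    exact ⟨a, by rw [ha, hdeg]⟩

theorem hasProjDim_whiskerIdeal (S : Finset V) :
    HasProjDim (whiskerIdeal K (S : Set V)) S.card := by
  refine ⟨⟨(exists_resolution_whiskerIdeal S).choose⟩, fun F => ?_⟩
  simp only [betti_whiskerIdeal_ne_zero_iff]
  exact ⟨⟨_, le_rfl, rfl⟩, fun i ⟨_, h, _⟩ => h⟩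

theorem hasRegularity_whiskerIdeal (S : Finset V) :
    HasRegularity (whiskerIdeal K (S : Set V)) S.card := by
  refine ⟨⟨(exists_resolution_whiskerIdeal S).choose⟩, fun F => ?_⟩
  simp only [betti_whiskerIdeal_ne_zero_iff]
  refine ⟨⟨_, _, ⟨le_rfl, rfl⟩, by push_cast; ring⟩, ?_⟩
  rintro _ ⟨i, _, ⟨h, rfl⟩, rfl⟩
  push_cast
  linarith [(Nat.cast_le (α := ℤ)).2 h]

end WhiskerIdeal

theorem mainTheorem7 {V : Type*} [Fintype V] (K : Type*) [Field K] (G : SimpleGraph V) :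
    HasRegularity (G.whiskered.closedNbhdIdeal K) (G.whiskered.matchingNumber : ℤ) ∧
    HasProjDim (G.whiskered.closedNbhdIdeal K) G.whiskered.matchingNumber ∧
    G.whiskered.closedNbhdIdeal K =
      Ideal.span (Set.range fun v : V =>
        (X (Sum.inl v) * X (Sum.inr v) : MvPolynomial (V ⊕ V) K)) ∧
    G.whiskered.matchingNumber = Fintype.card V := by
  have hm : G.whiskered.matchingNumber = Fintype.card V := by
    rw [G.matchingNumber_whiskered, Nat.card_eq_fintype_card]
  have hI : G.whiskered.closedNbhdIdeal K =
      whiskerIdeal K ((Finset.univ : Finset V) : Set V) := by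
    rw [G.closedNbhdIdeal_whiskered K, whiskerIdeal, Finset.coe_univ, Set.image_univ]
  refine ⟨?_, ?_, G.closedNbhdIdeal_whiskered K, hm⟩
  · rw [hm, hI]
    exact hasRegularity_whiskerIdeal _
  · rw [hm, hI]
    exact hasProjDim_whiskerIdeal _
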